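/- Let $X$ be a Tychonoff space and let $C_p(X)$ be the space of continuous functions $X\to\mathbb R$ with the topology of pointwise convergence. Definitions. A subset $D$ of a space $Z$ is sequentially dense if every point of $Z$ is the limit of a sequence of elements of $D$; $Z$ is sequentially separable if it has a countable sequentially dense subset. A set $A\subseteq Z$ converges to $z\in Z$ if $A$ is infinite, $z\notin A$, and $A\setminus W$ is finite for every neighbourhood $W$ of $z$. Let $\mathcal S$ be the family of sequentially dense subsets of $C_p(X)$ and, for $f\in C_p(X)$, let $\Gamma_f$ be the family of subsets of $C_p(X)$ that converge to $f$. Call a sequence $(\mathcal F_n)_{n}$ of finite subsets of $C_p(X)$ *$U$-convergent* to $f\in C_p(X)$ if for every finite $K\subseteq X$ and every $\varepsilon>0$ there is $n'$ such that for all $n>n'$ and all $x\in K$ there is $g\in\mathcal F_n$ with $|g(x)-f(x)|<\varepsilon$. Then: - $C_p(X)\models U_{fin}(\mathcal S,\mathcal S)$ means: for all $S_1,S_2,\dots\in\mathcal S$ there are finite $\mathcal F_n\subseteq S_n$ such that $(\mathcal F_n)$ is $U$-convergent to every $f\in C_p(X)$; - $C_p(X)\models U_{fin}(\Gamma_x,\Gamma_x)$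 means: for every $f\in C_p(X)$ and all $S_1,S_2,\dots\in\Gamma_f$ there are finite $\mathcal F_n\subseteq S_n$ such that $(\mathcal F_n)$ is $U$-convergent to $f$; - $C_p(X)\models U_{fin}(\mathcal S,\Gamma_x)$ means: for every $f\in C_p(X)$ and all $S_1,S_2,\dots\in\mathcal S$ there are finite $\mathcal F_n\subseteq S_n$ such that $(\mathcal F_n)$ is $U$-convergent to $f$. A $\gamma$-cover of $X$ is an infinite family $\mathcal U$ of subsets of $X$ with $\bigcup\mathcal U=X$ and $X\notin\mathcal U$ such that every $x\in X$ belongs to all but finitely many members of $\mathcal U$. Let $\Gamma$ be the family of $\gamma$-covers of $X$ by open sets. Let $\Gamma_F$ be the family of $\gamma$-covers $\mathcal U$ of $X$ by cozero-sets for which there is a $\gamma$-cover $\{F(U):U\in\mathcal U\}$ of $X$ by zero-sets with $F(U)\subseteq U$ for every $U\in\mathcal U$. Here a zero-set of $X$ is the preimage of $0$ under a continuous real-valued function on $X$, and a cozero-set is the complement of a zero-set. $X\models U_{fin}(\Gamma_F,\Gamma)$ means: whenever $\mathcal U_1,\mathcal U_2,\dots\in\Gamma_F$ and no $\mathcal U_n$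 contains a finite subcover of $X$, there are finite $\mathcal F_n\subseteq\mathcal U_n$ such that $\{\bigcup\mathcal F_n:n\}\in\Gamma$. $X$ has property $V$ if there are a separable metric space $Y$ and a continuous bijection $f:X\to Y$ such that $f(U)$ is an $F_\sigma$-set of $Y$ for every cozero-set $U$ of $X$. **Theorem.** The following are equivalent: 1. $C_p(X)\models U_{fin}(\mathcal S,\mathcal S)$ and $C_p(X)$ is sequentially separable; 2. $X\models U_{fin}(\Gamma_F,\Gamma)$ and $X$ has property $V$; 3. $C_p(X)\models U_{fin}(\Gamma_x,\Gamma_x)$ and $C_p(X)$ is sequentially separable; 4. $C_p(X)\models U_{fin}(\mathcal S,\Gamma_x)$ and $C_p(X)$ is sequentially separable. -/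

import Mathlib

open Set Filter Topology

universe u

namespace CpSel

section Spaces

variable {X : Type u} [TopologicalSpace X]

/-- A zero-set: the preimage of zero under a continuous real-valued function. -/
def IsZeroSet (Z : Set X) : Prop :=
  ∃ f : X → ℝ, Continuous f ∧ Z = {x | f x = 0}

/-- A cozero-set (functionally open set): the complement of a zero-set. -/
def IsCozeroSet (U : Set X) : Prop :=
  IsZeroSet Uᶜ

/-- An `F_σ`-set: the union of a countable family of closed sets. -/
def IsFSigma (A : Set X) : Prop :=
  ∃ T : Set (Set X), T.Countable ∧ (∀ C ∈ T, IsClosed C) ∧ A = ⋃₀ T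

/-- A `γ`-cover: a nontrivial cover (the whole space is not a member) that is infinite and such
that each point belongs to all but finitely many of its members. -/
def IsGammaCover (𝒰 : Set (Set X)) : Prop :=
  ⋃₀ 𝒰 = univ ∧ univ ∉ 𝒰 ∧ 𝒰.Infinite ∧ ∀ x : X, {U ∈ 𝒰 | x ∉ U}.Finite

variable (X) in
/-- `Γ`: the family of open `γ`-covers. -/
def Gamma : Set (Set (Set X)) :=
  {𝒰 | IsGammaCover 𝒰 ∧ ∀ U ∈ 𝒰, IsOpen U}

variable (X) in
/-- `Γ_F`: the family of `γ_F`-shrinkable `γ`-covers, that is, of `γ`-covers by cozero-sets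
such that there is a `γ`-cover `{F U : U ∈ 𝒰}` by zero-sets with `F U ⊆ U` for all `U ∈ 𝒰`. -/
def GammaF : Set (Set (Set X)) :=
  {𝒰 | IsGammaCover 𝒰 ∧ (∀ U ∈ 𝒰, IsCozeroSet U) ∧
    ∃ F : Set X → Set X, IsGammaCover (F '' 𝒰) ∧ ∀ U ∈ 𝒰, IsZeroSet (F U) ∧ F U ⊆ U}

/-- The selection principle `U_fin(𝒜, ℬ)` for families of covers of `X`: for each sequence of
members of `𝒜`, none of which contains a finite subcover, there are finite subfamilies whose
unions form a member of `ℬ`. -/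
def UFin (𝒜 ℬ : Set (Set (Set X))) : Prop :=
  ∀ 𝒰 : ℕ → Set (Set X), (∀ n, 𝒰 n ∈ 𝒜) →
    (∀ n, ¬ ∃ ℱ : Set (Set X), ℱ ⊆ 𝒰 n ∧ ℱ.Finite ∧ ⋃₀ ℱ = univ) →
    ∃ ℱ : ℕ → Set (Set X), (∀ n, ℱ n ⊆ 𝒰 n ∧ (ℱ n).Finite) ∧
      range (fun n => ⋃₀ ℱ n) ∈ ℬ

variable (X) in
/-- Property `V`: there is a condensation (continuous bijection) of `X` onto a separable metric
space that maps each cozero-set of `X` to an `F_σ`-set. (A condensation is bijective, so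
restricting `Y` to the universe of `X` loses nothing.) -/
def PropertyV : Prop :=
  ∃ (Y : Type u) (_ : MetricSpace Y) (_ : TopologicalSpace.SeparableSpace Y) (f : X → Y),
    Continuous f ∧ Function.Bijective f ∧ ∀ U : Set X, IsCozeroSet U → IsFSigma (f '' U)

variable (X) in
/-- A sequentially dense set: each point of the space is the limit of a sequence from it. -/
def SeqDense : Set (Set X) :=
  {D | seqClosure D = univ}

variable (X) in
/-- A sequentially separable space: one with a countable sequentially dense subset. -/
def SequentiallySeparable : Prop :=
  ∃ D : Set X, D.Countable ∧ D ∈ SeqDense X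

/-- `Γ_x`: the family of sets converging to `x`, that is, of infinite sets `A` with `x ∉ A`
such that `A \ U` is finite for each neighbourhood `U` of `x`. -/
def GammaAt (x : X) : Set (Set X) :=
  {A | A.Infinite ∧ x ∉ A ∧ ∀ U ∈ 𝓝 x, (A \ U).Finite}

end Spaces

/-- `C_p(X)`: the continuous real-valued functions on `X` with the topology of pointwise
convergence (the subspace topology induced from the product `ℝ^X`). -/
abbrev Cp (X : Type u) [TopologicalSpace X] : Type u :=
  {f : X → ℝ // Continuous f}

section FunctionSpaces

variable {X : Type u} [TopologicalSpace X]

/-- The sets `ℱ n` of functions `U`-converge to `f`: for each basic neighbourhood `⟨f, K, ε⟩`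
of `f`, for all but finitely many `n` each point `x ∈ K` has some `g ∈ ℱ n` with
`|g x - f x| < ε` (the function `g` may depend on `x`). -/
def UConverges (ℱ : ℕ → Set (Cp X)) (f : Cp X) : Prop :=
  ∀ (K : Finset X) (ε : ℝ), 0 < ε →
    ∃ N : ℕ, ∀ n > N, ∀ x ∈ K, ∃ g ∈ ℱ n, |g.1 x - f.1 x| < ε

variable (X) in
/-- `C_p(X) ⊨ U_fin(𝒮, 𝒮)`: one selection works for all `f`. -/
def UFinSS : Prop :=
  ∀ S : ℕ → Set (Cp X), (∀ n, S n ∈ SeqDense (Cp X)) →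
    ∃ ℱ : ℕ → Set (Cp X), (∀ n, ℱ n ⊆ S n ∧ (ℱ n).Finite) ∧ ∀ f : Cp X, UConverges ℱ f

variable (X) in
/-- `C_p(X) ⊨ U_fin(Γ_x, Γ_x)`, at each point `x = f` of `C_p(X)`. -/
def UFinGammaGamma : Prop :=
  ∀ f : Cp X, ∀ S : ℕ → Set (Cp X), (∀ n, S n ∈ GammaAt f) →
    ∃ ℱ : ℕ → Set (Cp X), (∀ n, ℱ n ⊆ S n ∧ (ℱ n).Finite) ∧ UConverges ℱ f

variable (X) in
/-- `C_p(X) ⊨ U_fin(𝒮, Γ_x)`, at each point `x = f` of `C_p(X)`. -/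
def UFinSGamma : Prop :=
  ∀ f : Cp X, ∀ S : ℕ → Set (Cp X), (∀ n, S n ∈ SeqDense (Cp X)) →
    ∃ ℱ : ℕ → Set (Cp X), (∀ n, ℱ n ⊆ S n ∧ (ℱ n).Finite) ∧ UConverges ℱ f

end FunctionSpaces

end CpSel

namespace CpSel

/-! ### Covers: zero-sets, `Γ_F`, and a sequential form of `U_fin(Γ_F, Γ)`. -/

section Covers

variable {X : Type u} [TopologicalSpace X]

/-! Each condition has a selection half and a separability half. The selection halves are compared
through `SeqUFin`, which uses sequences of sets and no nontriviality assumptions. If `g k → f`, the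
cozero-sets `{|g k - f| < ε}` shrink to zero-sets that eventually contain each point, so `SeqUFin`
gives selections in `C_p(X)` (`SeqUFin.exists_uConverges`). Conversely, a shrinkable cover yields a
sequentially dense set of functions, each equal to `1` off a member of the cover
(`UFinSGamma.seqUFin`).

Property `V` corresponds to sequential separability. A countable sequentially dense set `D`
condenses `X` onto a subspace of `ℝ^D`. Conversely, `F_σ` images allow every continuous function on
`X` to be approximated pointwise by continuous functions on the Hilbert cube
(`exists_seq_tendsto_of_closed`), which have a countable uniformly dense set. -/

theorem IsZeroSet.inter {A B : Set X} (hA : IsZeroSet A) (hB : IsZeroSet B) :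
    IsZeroSet (A ∩ B) := by
  obtain ⟨f, hf, rfl⟩ := hA
  obtain ⟨g, hg, rfl⟩ := hB
  refine ⟨fun x => |f x| + |g x|, by fun_prop, ?_⟩
  ext x
  simp only [mem_inter_iff, mem_ofPred_eq]
  rw [add_eq_zero_iff_of_nonneg (abs_nonneg _) (abs_nonneg _), abs_eq_zero, abs_eq_zero]

theorem IsZeroSet.union {A B : Set X} (hA : IsZeroSet A) (hB : IsZeroSet B) :
    IsZeroSet (A ∪ B) := by
  obtain ⟨f, hf, rfl⟩ := hA
  obtain ⟨g, hg, rfl⟩ := hB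
  refine ⟨fun x => f x * g x, by fun_prop, ?_⟩
  ext x
  simp

theorem IsCozeroSet.inter {A B : Set X} (hA : IsCozeroSet A) (hB : IsCozeroSet B) :
    IsCozeroSet (A ∩ B) := by
  unfold IsCozeroSet at *
  rw [compl_inter]
  exact hA.union hB

theorem isZeroSet_univ : IsZeroSet (univ : Set X) :=
  ⟨fun _ => 0, continuous_const, by simp⟩

theorem isCozeroSet_univ : IsCozeroSet (univ : Set X) :=
  ⟨fun _ => 1, continuous_const, by simp⟩

theorem IsCozeroSet.isOpen {A : Set X} (hA : IsCozeroSet A) : IsOpen A := by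
  obtain ⟨f, hf, h⟩ := hA
  rw [← isClosed_compl_iff, h]
  exact isClosed_eq hf continuous_const

theorem isZeroSet_biInter {ι : Type*} (s : Finset ι) {F : ι → Set X}
    (h : ∀ i, IsZeroSet (F i)) : IsZeroSet (⋂ i ∈ s, F i) := by
  classical
  induction s using Finset.induction_on with
  | empty => simpa using isZeroSet_univ
  | insert a s _ ih =>
    rw [Finset.set_biInter_insert]
    exact (h a).inter ih

theorem isCozeroSet_biInter {ι : Type*} (s : Finset ι) {U : ι → Set X}
    (h : ∀ i, IsCozeroSet (U i)) : IsCozeroSet (⋂ i ∈ s, U i) := by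
  classical
  induction s using Finset.induction_on with
  | empty => simpa using isCozeroSet_univ
  | insert a s _ ih =>
    rw [Finset.set_biInter_insert]
    exact (h a).inter ih

/-- A zero-set inside a cozero-set is separated from its complement by a continuous function. -/
theorem exists_continuous_separating {F U : Set X} (hF : IsZeroSet F) (hU : IsCozeroSet U)
    (hFU : F ⊆ U) :
    ∃ φ : X → ℝ, Continuous φ ∧ (∀ x ∈ F, φ x = 0) ∧ ∀ x ∉ U, φ x = 1 := by
  obtain ⟨f, hf, rfl⟩ := hF
  obtain ⟨g, hg, hgU⟩ := hU
  have hU : ∀ x, x ∉ U ↔ g x = 0 := fun x => by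
    rw [← mem_compl_iff, hgU, mem_ofPred_eq]
  have hpos : ∀ x, |f x| + |g x| ≠ 0 := fun x hx => by
    rw [add_eq_zero_iff_of_nonneg (abs_nonneg _) (abs_nonneg _), abs_eq_zero, abs_eq_zero] at hx
    exact (hU x).2 hx.2 (hFU hx.1)
  refine ⟨fun x => |f x| / (|f x| + |g x|), by fun_prop (disch := exact hpos _), ?_, ?_⟩
  · intro x hx
    rw [mem_ofPred_eq] at hx
    simp [hx]
  · intro x hx
    have h0 := (hU x).1 hx
    have := hpos x
    simp only [h0, abs_zero, add_zero] at this ⊢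
    exact div_self this

omit [TopologicalSpace X] in
/-- A family of proper subsets over an infinite index set such that each point lies in all but
finitely many of them has a `γ`-cover as its range. -/
theorem isGammaCover_range {ι : Type*} [Infinite ι] {U : ι → Set X} (hU : ∀ i, U i ≠ univ)
    (h : ∀ x, {i | x ∉ U i}.Finite) : IsGammaCover (range U) := by
  refine ⟨?_, ?_, ?_, ?_⟩
  · refine eq_univ_of_forall fun x => ?_
    obtain ⟨i, hi⟩ := (h x).infinite_compl.nonempty
    exact ⟨U i, mem_range_self i, not_not.1 hi⟩
  · rintro ⟨i, hi⟩
    exact hU i hi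
  · intro hfin
    have := hfin.to_subtype
    -- A set repeated infinitely often cannot miss any point, so it would be the whole space.
    obtain ⟨y, hy⟩ := Finite.exists_infinite_fiber (rangeFactorization U)
    rw [infinite_coe_iff] at hy
    obtain ⟨i, hi⟩ := hy.nonempty
    refine hU i (eq_univ_of_forall fun x => ?_)
    by_contra hx
    refine hy ((h x).subset fun j hj => ?_)
    have : U j = U i := congrArg Subtype.val (hj.trans hi.symm : _)
    rwa [mem_ofPred_eq, this]
  · intro x
    refine ((h x).image U).subset ?_
    rintro _ ⟨⟨i, rfl⟩, hi⟩
    exact ⟨i, hi, rfl⟩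

/-- Sequences of cozero-sets that shrink to zero-sets containing each point eventually give
members of `Γ_F`. -/
theorem range_mem_gammaF {U F : ℕ → Set X} (hU : ∀ k, IsCozeroSet (U k))
    (hF : ∀ k, IsZeroSet (F k)) (hFU : ∀ k, F k ⊆ U k) (hne : ∀ k, U k ≠ univ)
    (h : ∀ x, {k | x ∉ F k}.Finite) : range U ∈ GammaF X := by
  have hγ : IsGammaCover (range U) :=
    isGammaCover_range hne fun x => (h x).subset fun k hk hx => hk (hFU k hx)
  refine ⟨hγ, ?_, ?_⟩
  · rintro _ ⟨k, rfl⟩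
    exact hU k
  -- `U` may repeat values while the shrinking is a function of the set, so one index is fixed per
  -- member.
  have hex : ∀ W : range U, ∃ k, U k = W := fun W => W.2
  choose κ hκ using hex
  have hκ_inj : Function.Injective κ := fun V W hVW => by
    apply Subtype.ext
    rw [← hκ V, hVW, hκ]
  classical
  let G : Set X → Set X := fun W => if hW : W ∈ range U then F (κ ⟨W, hW⟩) else ∅
  have hG : ∀ W : range U, G W = F (κ W) := fun W => by
    rw [show G W = if hW : (W : Set X) ∈ range U then F (κ ⟨W, hW⟩) else ∅ from rfl, dif_pos W.2]
  refine ⟨G, ?_, fun W hW => ?_⟩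
  · have := hγ.2.2.1.to_subtype
    rw [image_eq_range]
    refine isGammaCover_range (fun W hW => ?_) fun x => ?_
    · rw [hG] at hW
      exact hne _ (univ_subset_iff.1 (hW ▸ hFU _))
    · refine ((h x).preimage hκ_inj.injOn).subset fun W hW => ?_
      rw [mem_ofPred_eq, hG] at hW
      exact hW
  · rw [hG ⟨W, hW⟩]
    refine ⟨hF _, (hFU _).trans ?_⟩
    rw [hκ ⟨W, hW⟩]

/-- Each member of `Γ_F` contains a sequence of sets shrinking to zero-sets that contain each
point eventually. -/
theorem exists_seq_of_mem_gammaF {𝒰 : Set (Set X)} (h𝒰 : 𝒰 ∈ GammaF X) :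
    ∃ U F : ℕ → Set X, (∀ k, U k ∈ 𝒰) ∧ (∀ k, IsZeroSet (F k)) ∧ (∀ k, F k ⊆ U k) ∧
      ∀ x, {k | x ∉ F k}.Finite := by
  obtain ⟨-, -, G, hG, hGU⟩ := h𝒰
  have hmem : ∀ k, ∃ U ∈ 𝒰, G U = hG.2.2.1.natEmbedding _ k := fun k =>
    (hG.2.2.1.natEmbedding _ k).2
  choose U hU hGk using hmem
  refine ⟨U, fun k => G (U k), hU, fun k => (hGU _ (hU k)).1, fun k => (hGU _ (hU k)).2,
    fun x => ?_⟩
  have hinj : Function.Injective fun k => G (U k) := fun i j hij => by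
    simp only [hGk] at hij
    exact (hG.2.2.1.natEmbedding _).injective (Subtype.ext hij)
  exact ((hG.2.2.2 x).preimage hinj.injOn).subset fun k hk => ⟨mem_image_of_mem G (hU k), hk⟩

variable (X) in
/-- The selection principle `U_fin(Γ_F, Γ)` in terms of sequences of sets. -/
def SeqUFin : Prop :=
  ∀ U F : ℕ → ℕ → Set X, (∀ n k, IsCozeroSet (U n k)) → (∀ n k, IsZeroSet (F n k)) →
    (∀ n k, F n k ⊆ U n k) → (∀ n x, {k | x ∉ F n k}.Finite) →
    ∃ b : ℕ → ℕ, ∀ x, ∀ᶠ n in atTop, ∃ k ≤ b n, x ∈ U n k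

theorem SeqUFin.uFin (h : SeqUFin X) : UFin (GammaF X) (Gamma X) := by
  intro 𝒰 h𝒰 hsub
  choose U F hU hF hFU hfin using fun n => exists_seq_of_mem_gammaF (h𝒰 n)
  obtain ⟨b, hb⟩ := h U F (fun n k => (h𝒰 n).2.1 _ (hU n k)) hF hFU hfin
  have hmem : ∀ n, U n '' Iic (b n) ⊆ 𝒰 n := by
    rintro n _ ⟨k, -, rfl⟩
    exact hU n k
  have hfinite : ∀ n, (U n '' Iic (b n)).Finite := fun n => (finite_Iic _).image _
  refine ⟨fun n => U n '' Iic (b n), fun n => ⟨hmem n, hfinite n⟩,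
    isGammaCover_range (fun n hn => hsub n ⟨_, hmem n, hfinite n, hn⟩) fun x => ?_, ?_⟩
  · have := hb x
    rw [← Nat.cofinite_eq_atTop, eventually_cofinite] at this
    refine this.subset fun n hn hx => hn ?_
    obtain ⟨k, hk, hx⟩ := hx
    exact ⟨U n k, mem_image_of_mem _ hk, hx⟩
  · rintro _ ⟨n, rfl⟩
    refine isOpen_sUnion ?_
    rintro _ ⟨k, -, rfl⟩
    exact ((h𝒰 n).2.1 _ (hU n k)).isOpen

/-- `UFin` yields only a set of unions, which forgets indices and may skip stages. Intersecting the
earlier covers makes any later stage usable for stage `n`. Stages where finitely many sets already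
cover are treated separately. -/
theorem UFin.seqUFin (h : UFin (GammaF X) (Gamma X)) : SeqUFin X := by
  intro U F hU hF hFU hfin
  classical
  let N : Set ℕ := {n | ∀ b, ∃ x, ∀ k ≤ b, x ∉ U n k}
  have hN : ∀ n, n ∉ N → ∃ b, ∀ x, ∃ k ≤ b, x ∈ U n k := fun n hn => by
    simpa [N] using hn
  rcases N.eq_empty_or_nonempty with hemp | ⟨m, hm⟩
  · have hN' : ∀ n, ∃ b, ∀ x, ∃ k ≤ b, x ∈ U n k := fun n => hN n (by simp [hemp])
    choose b hb using hN'
    exact ⟨b, fun x => Eventually.of_forall fun n => hb n x⟩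
  -- Contains `m`, so `W n` has no finite subcover, and every index of `N` up to `n`, so `W n`
  -- refines those covers.
  let s : ℕ → Finset ℕ := fun n => {i ∈ Finset.range (n + m + 1) | i ∈ N}
  have hms : ∀ n, m ∈ s n := fun n => by simp [s, hm]
  let W : ℕ → ℕ → Set X := fun n k => ⋂ i ∈ s n, U i k
  have hWU : ∀ n, ∀ i ∈ s n, ∀ k, W n k ⊆ U i k := fun n i hi k => biInter_subset_of_mem hi
  have hcov : ∀ n b, ∃ x, ∀ k ≤ b, x ∉ W n k := fun n b => by
    obtain ⟨x, hx⟩ := hm b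
    exact ⟨x, fun k hk hxk => hx k hk (hWU n m (hms n) k hxk)⟩
  have hbd : ∀ n (ℱ : Set (Set X)), ℱ ⊆ range (W n) → ℱ.Finite →
      ∃ b, ∀ V ∈ ℱ, ∃ k ≤ b, W n k = V := by
    intro n ℱ hℱ hfinℱ
    have hex : ∀ V ∈ ℱ, ∃ k, W n k = V := fun V hV => hℱ hV
    choose! κ hκ using hex
    obtain ⟨b, hb⟩ := (hfinℱ.image κ).bddAbove
    exact ⟨b, fun V hV => ⟨κ V, hb (mem_image_of_mem κ hV), hκ V hV⟩⟩
  obtain ⟨ℱ, hℱ, hγ, -⟩ := h (fun n => range (W n))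
    (fun n => range_mem_gammaF (F := fun k => ⋂ i ∈ s n, F i k)
      (fun k => isCozeroSet_biInter _ fun i => hU i k)
      (fun k => isZeroSet_biInter _ fun i => hF i k)
      (fun k => iInter₂_mono fun i _ => hFU i k)
      (fun k hk => by
        obtain ⟨x, hx⟩ := hcov n k
        exact hx k le_rfl (hk ▸ mem_univ x))
      (fun x => ((s n).finite_toSet.biUnion fun i _ => hfin i x).subset fun k hk => by
        simp only [mem_ofPred_eq, mem_iInter, not_forall] at hk
        obtain ⟨i, hi, hx⟩ := hk
        exact mem_biUnion hi hx))
    (by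
      rintro n ⟨ℱ, hℱ, hfinℱ, hcovℱ⟩
      obtain ⟨b, hb⟩ := hbd n ℱ hℱ hfinℱ
      obtain ⟨x, hx⟩ := hcov n b
      obtain ⟨V, hV, hxV⟩ := hcovℱ.symm ▸ mem_univ x
      obtain ⟨k, hk, rfl⟩ := hb V hV
      exact hx k hk hxV)
  choose β hβ using fun n => hbd n (ℱ n) (hℱ n).1 (hℱ n).2
  let A : ℕ → Set X := fun n => ⋃₀ ℱ n
  -- First occurrences: on `T` the unions are distinct, so finiteness for sets becomes finiteness
  -- for indices.
  let T : Set ℕ := {j | ∀ i < j, A i ≠ A j}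
  have hTinj : InjOn A T := by
    intro i hi j hj hij
    rcases lt_trichotomy i j with hlt | heq | hlt
    · exact absurd hij (hj i hlt)
    · exact heq
    · exact absurd hij.symm (hi j hlt)
  have hT : T.Infinite := by
    intro hTfin
    refine hγ.2.2.1 ((hTfin.image A).subset ?_)
    rintro _ ⟨j, rfl⟩
    have hex : ∃ i, A i = A j := ⟨j, rfl⟩
    exact ⟨Nat.find hex, fun i hi heq => Nat.find_min hex hi (heq.trans (Nat.find_spec hex)),
      Nat.find_spec hex⟩
  choose τ hτT hτ using fun n => hT.exists_gt n
  choose! c hc using hN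
  refine ⟨fun n => if n ∈ N then β (τ n) else c n, fun x => ?_⟩
  have hx : {j ∈ T | x ∉ A j}.Finite := by
    refine Finite.of_finite_image ((hγ.2.2.2 x).subset ?_) (hTinj.mono fun j hj => hj.1)
    rintro _ ⟨j, hj, rfl⟩
    exact ⟨mem_range_self j, hj.2⟩
  obtain ⟨M, hM⟩ := hx.bddAbove
  filter_upwards [eventually_ge_atTop M] with n hn
  split_ifs with hnN
  · have hxA : x ∈ A (τ n) := by
      by_contra hxA
      exact absurd (hM ⟨hτT n, hxA⟩) (by have := hτ n; omega)
    obtain ⟨V, hV, hxV⟩ := hxA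
    obtain ⟨k, hk, rfl⟩ := hβ _ V hV
    refine ⟨k, hk, hWU (τ n) n ?_ k hxV⟩
    have := hτ n
    simp only [s, Finset.mem_filter, Finset.mem_range]
    exact ⟨by omega, hnN⟩
  · exact hc n hnN x

end Covers

/-! ### Selection principles in `C_p(X)`. -/

section Selection

variable {X : Type u} [TopologicalSpace X]

theorem uConverges_iff {ℱ : ℕ → Set (Cp X)} {f : Cp X} :
    UConverges ℱ f ↔ ∀ x, ∀ ε > 0, ∀ᶠ n in atTop, ∃ g ∈ ℱ n, |g.1 x - f.1 x| < ε := by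
  constructor
  · intro h x ε hε
    obtain ⟨N, hN⟩ := h {x} ε hε
    filter_upwards [eventually_gt_atTop N] with n hn
    exact hN n hn x (Finset.mem_singleton_self x)
  · intro h K ε hε
    have := (eventually_all_finset K).2 fun x _ => h x ε hε
    obtain ⟨N, hN⟩ := eventually_atTop.1 this
    exact ⟨N, fun n hn => hN n hn.le⟩

theorem tendsto_cp_iff {ι : Type*} {l : Filter ι} {g : ι → Cp X} {f : Cp X} :
    Tendsto g l (𝓝 f) ↔ ∀ x, Tendsto (fun i => (g i).1 x) l (𝓝 (f.1 x)) := by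
  rw [tendsto_subtype_rng, tendsto_pi_nhds]

theorem mem_seqDense_iff {D : Set (Cp X)} :
    D ∈ SeqDense (Cp X) ↔ ∀ f, ∃ g : ℕ → Cp X, (∀ k, g k ∈ D) ∧ Tendsto g atTop (𝓝 f) :=
  eq_univ_iff_forall

theorem SeqUFin.exists_uConverges (h : SeqUFin X) (f : Cp X) {g : ℕ → ℕ → Cp X}
    (hg : ∀ n, Tendsto (g n) atTop (𝓝 f)) :
    ∃ b : ℕ → ℕ, UConverges (fun n => g n '' Iic (b n)) f := by
  have hpos : ∀ n : ℕ, (0 : ℝ) < 1 / ((n : ℝ) + 1) := fun n => Nat.one_div_pos_of_nat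
  obtain ⟨b, hb⟩ := h (fun n k => {x | |(g n k).1 x - f.1 x| < 1 / ((n : ℝ) + 1)})
    (fun n k => {x | |(g n k).1 x - f.1 x| ≤ 1 / ((n : ℝ) + 1) / 2})
    (fun n k => ⟨fun x => max (1 / ((n : ℝ) + 1) - |(g n k).1 x - f.1 x|) 0, by
      have := (g n k).2
      have := f.2
      fun_prop, by
      ext x
      simp [-one_div]⟩)
    (fun n k => ⟨fun x => max (|(g n k).1 x - f.1 x| - 1 / ((n : ℝ) + 1) / 2) 0, by
      have := (g n k).2
      have := f.2
      fun_prop, by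
      ext x
      simp [-one_div]⟩)
    (fun n k x hx => lt_of_le_of_lt hx (half_lt_self (hpos n)))
    (fun n x => by
      have := (tendsto_cp_iff.1 (hg n) x)
      have := Metric.tendsto_nhds.1 this _ (half_pos (hpos n))
      rw [← Nat.cofinite_eq_atTop, eventually_cofinite] at this
      refine this.subset fun k hk hlt => hk ?_
      rw [Real.dist_eq] at hlt
      exact hlt.le)
  refine ⟨b, uConverges_iff.2 fun x ε hε => ?_⟩
  filter_upwards [hb x, tendsto_one_div_add_atTop_nhds_zero_nat.eventually_lt_const hε]
    with n ⟨k, hk, hx⟩ hn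
  exact ⟨g n k, mem_image_of_mem _ hk, lt_trans hx hn⟩

theorem SeqUFin.uFinGammaGamma (h : SeqUFin X) : UFinGammaGamma X := by
  intro f S hS
  let g : ℕ → ℕ → Cp X := fun n k => (hS n).1.natEmbedding _ k
  obtain ⟨b, hb⟩ := h.exists_uConverges f (g := g) fun n => by
    rw [← Nat.cofinite_eq_atTop, tendsto_def]
    intro V hV
    refine (((hS n).2.2 V hV).preimage
      (Subtype.val_injective.comp ((hS n).1.natEmbedding _).injective).injOn).subset ?_
    intro k hk
    exact ⟨((hS n).1.natEmbedding _ k).2, hk⟩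
  refine ⟨_, fun n => ⟨?_, (finite_Iic _).image _⟩, hb⟩
  rintro _ ⟨k, -, rfl⟩
  exact ((hS n).1.natEmbedding _ k).2

/-- Stage `n` serves the first `n + 1` members of a countable sequentially dense set; being
`U`-approximated then passes to pointwise limits. -/
theorem SeqUFin.uFinSS (h : SeqUFin X) (hX : SequentiallySeparable (Cp X)) : UFinSS X := by
  intro S hS
  obtain ⟨D, hDc, hD⟩ := hX
  have hDne : D.Nonempty := by
    obtain ⟨g, hg, -⟩ := mem_seqDense_iff.1 hD ⟨fun _ => 0, continuous_const⟩
    exact ⟨g 0, hg 0⟩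
  obtain ⟨d, rfl⟩ := hDc.exists_eq_range hDne
  choose g hgS hg using fun j n => mem_seqDense_iff.1 (hS n) (d j)
  choose b hb using fun j => h.exists_uConverges (d j) (hg j)
  refine ⟨fun n => ⋃ j ∈ Iic n, g j n '' Iic (b j n), fun n => ⟨?_, ?_⟩, fun f => ?_⟩
  · refine iUnion₂_subset fun j _ => ?_
    rintro _ ⟨k, -, rfl⟩
    exact hgS j n k
  · exact (finite_Iic n).biUnion fun j _ => (finite_Iic _).image _
  · refine uConverges_iff.2 fun x ε hε => ?_
    obtain ⟨e, he, hef⟩ := mem_seqDense_iff.1 hD f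
    obtain ⟨i, hi⟩ :=
      (Metric.tendsto_nhds.1 (tendsto_cp_iff.1 hef x) _ (half_pos hε)).exists
    obtain ⟨j, hj⟩ := he i
    rw [← hj, Real.dist_eq] at hi
    filter_upwards [uConverges_iff.1 (hb j) x _ (half_pos hε), eventually_ge_atTop j]
      with n ⟨q, hq, hqx⟩ hjn
    refine ⟨q, mem_biUnion (mem_Iic.2 hjn) hq, ?_⟩
    calc |q.1 x - f.1 x| ≤ |q.1 x - (d j).1 x| + |(d j).1 x - f.1 x| := abs_sub_le _ _ _
      _ < ε := by linarith

theorem UFinSS.uFinSGamma (h : UFinSS X) : UFinSGamma X := fun f S hS => by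
  obtain ⟨ℱ, hℱ, hconv⟩ := h S hS
  exact ⟨ℱ, hℱ, hconv f⟩

/-- A sequentially dense set that misses `f` contains a set converging to `f`. -/
theorem exists_subset_mem_gammaAt {S : Set (Cp X)} (hS : S ∈ SeqDense (Cp X)) {f : Cp X}
    (hf : f ∉ S) : ∃ A ⊆ S, A ∈ GammaAt f := by
  obtain ⟨g, hgS, hg⟩ := mem_seqDense_iff.1 hS f
  have hT1 : T1Space (Cp X) := inferInstance
  have hsub : range g ⊆ S := range_subset_iff.2 hgS
  refine ⟨range g, hsub, fun hfin => ?_, fun h => hf (hsub h), fun V hV => ?_⟩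
  · have hmem : (range g)ᶜ ∈ 𝓝 f := hfin.isClosed.isOpen_compl.mem_nhds fun h => hf (hsub h)
    obtain ⟨k, hk⟩ := (hg.eventually hmem).exists
    exact hk (mem_range_self k)
  · have := hg.eventually hV
    rw [← Nat.cofinite_eq_atTop, eventually_cofinite] at this
    refine (this.image g).subset ?_
    rintro _ ⟨⟨k, rfl⟩, hk⟩
    exact ⟨k, hk, rfl⟩

theorem UFinGammaGamma.uFinSGamma (h : UFinGammaGamma X) : UFinSGamma X := by
  intro f S hS
  classical
  by_cases hall : ∀ n, f ∈ S n
  · refine ⟨fun _ => {f}, fun n => ⟨singleton_subset_iff.2 (hall n), finite_singleton f⟩, ?_⟩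
    exact uConverges_iff.2 fun x ε hε => Eventually.of_forall fun n => ⟨f, rfl, by simpa⟩
  push Not at hall
  obtain ⟨m, hm⟩ := hall
  have hA : ∀ n, ∃ A ∈ GammaAt f, f ∉ S n → A ⊆ S n := fun n => by
    by_cases hn : f ∈ S n
    · obtain ⟨A, -, hA⟩ := exists_subset_mem_gammaAt (hS m) hm
      exact ⟨A, hA, fun h => absurd hn h⟩
    · obtain ⟨A, hAS, hA⟩ := exists_subset_mem_gammaAt (hS n) hn
      exact ⟨A, hA, fun _ => hAS⟩
  choose A hA hAS using hA
  obtain ⟨ℱ, hℱ, hconv⟩ := h f A hA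
  refine ⟨fun n => if f ∈ S n then {f} else ℱ n, fun n => ?_, uConverges_iff.2 fun x ε hε => ?_⟩
  · dsimp only
    split_ifs with hn
    · exact ⟨singleton_subset_iff.2 hn, finite_singleton f⟩
    · exact ⟨(hℱ n).1.trans (hAS n hn), (hℱ n).2⟩
  · filter_upwards [uConverges_iff.1 hconv x ε hε] with n hn
    split_ifs
    · exact ⟨f, rfl, by simpa⟩
    · exact hn

theorem UFinSGamma.seqUFin (h : UFinSGamma X) : SeqUFin X := by
  intro U F hU hF hFU hfin
  choose φ hφc hφ0 hφ1 using fun n k => exists_continuous_separating (hF n k) (hU n k) (hFU n k)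
  -- `G n (k, q)` agrees with `q` on `F n k`, which gives sequential density, and is `1` off `U n
  -- k`, so a value near `0` at `x` forces `x ∈ U n k`.
  let G : ℕ → ℕ × Cp X → Cp X := fun n p =>
    ⟨fun x => p.2.1 x * (1 - φ n p.1 x) + φ n p.1 x, by
      have := p.2.2
      have := hφc n p.1
      fun_prop⟩
  obtain ⟨ℱ, hℱ, hconv⟩ := h ⟨fun _ => 0, continuous_const⟩ (fun n => range (G n)) fun n =>
    mem_seqDense_iff.2 fun f => by
      refine ⟨fun k => G n (k, f), fun k => mem_range_self _, tendsto_cp_iff.2 fun x => ?_⟩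
      refine tendsto_const_nhds.congr' ?_
      rw [← Nat.cofinite_eq_atTop]
      filter_upwards [(hfin n x).compl_mem_cofinite] with k hk
      simp [G, hφ0 n k x (not_not.1 hk)]
  have hbd : ∀ n, ∃ b, ∀ g ∈ ℱ n, ∃ k ≤ b, ∃ q, G n (k, q) = g := fun n => by
    have hex : ∀ g ∈ ℱ n, ∃ p, G n p = g := fun g hg => (hℱ n).1 hg
    choose! p hp using hex
    obtain ⟨b, hb⟩ := ((hℱ n).2.image fun g => (p g).1).bddAbove
    exact ⟨b, fun g hg => ⟨(p g).1, hb ⟨g, hg, rfl⟩, (p g).2, hp g hg⟩⟩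
  choose b hb using hbd
  refine ⟨b, fun x => ?_⟩
  filter_upwards [uConverges_iff.1 hconv x 1 one_pos] with n ⟨g, hg, hgx⟩
  obtain ⟨k, hk, q, rfl⟩ := hb n g hg
  refine ⟨k, hk, ?_⟩
  by_contra hx
  simp [G, hφ1 n k x hx] at hgx

end Selection

/-! ### Pointwise approximation from closed sets with prescribed intervals. -/

section Interpolation

variable {K : Type*} [TopologicalSpace K]

/-- Finitely many closed sets with prescribed intervals, any two of which meet where the closed
sets do, admit a continuous function with values in the prescribed intervals. -/
theorem exists_continuous_mem_Icc [NormalSpace K] [ParacompactSpace K] {ι : Type*} (s : Finset ι)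
    {C : ι → Set K} {a b : ι → ℝ} (hC : ∀ i ∈ s, IsClosed (C i))
    (h : ∀ i ∈ s, ∀ j ∈ s, (C i ∩ C j).Nonempty → a i ≤ b j) :
    ∃ φ : C(K, ℝ), ∀ i ∈ s, ∀ x ∈ C i, φ x ∈ Icc (a i) (b i) := by
  classical
  obtain ⟨φ, hφ⟩ := exists_continuous_forall_mem_convex_of_local_const
    (t := fun x : K => ⋂ i ∈ s, {y : ℝ | x ∈ C i → y ∈ Icc (a i) (b i)})
    (fun x => convex_iInter₂ fun i _ => by
      by_cases hx : x ∈ C i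
      · simp only [hx, forall_const]
        exact convex_Icc (a i) (b i)
      · simpa [hx] using convex_univ)
    (fun x => by
      have hev : ∀ᶠ y in 𝓝 x, ∀ i ∈ s, y ∈ C i → x ∈ C i := by
        refine (eventually_all_finset s).2 fun i hi => ?_
        by_cases hx : x ∈ C i
        · exact Eventually.of_forall fun _ _ => hx
        · filter_upwards [(hC i hi).isOpen_compl.mem_nhds hx] with y hy hy'
          exact absurd hy' hy
      -- The largest lower endpoint among the sets through `x` lies in all their intervals.
      have hc : ∃ c, ∀ i ∈ s, x ∈ C i → c ∈ Icc (a i) (b i) := by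
        rcases ({i ∈ s | x ∈ C i} : Finset ι).eq_empty_or_nonempty with he | hne
        · refine ⟨0, fun i hi hx => ?_⟩
          have : i ∈ ({i ∈ s | x ∈ C i} : Finset ι) := Finset.mem_filter.2 ⟨hi, hx⟩
          simp [he] at this
        · obtain ⟨m, hm, hmax⟩ := Finset.exists_max_image _ a hne
          rw [Finset.mem_filter] at hm
          exact ⟨a m, fun i hi hx => ⟨hmax i (Finset.mem_filter.2 ⟨hi, hx⟩),
            h m hm.1 i hi ⟨x, hm.2, hx⟩⟩⟩
      obtain ⟨c, hc⟩ := hc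
      refine ⟨c, ?_⟩
      filter_upwards [hev] with y hy
      exact mem_iInter₂.2 fun i hi hyi => hc i hi (hy i hi hyi))
  exact ⟨φ, fun i hi x hx => mem_iInter₂.1 (hφ x) i hi hx⟩

/-- A function on a subset of a compact metrizable space is a pointwise limit of continuous
functions on the whole space if its values are determined by countably many closed sets. -/
theorem exists_seq_tendsto_of_closed [CompactSpace K] [TopologicalSpace.MetrizableSpace K]
    {Y : Type*} (e : Y → K) (g : Y → ℝ) (C : ℕ → Set K) (a b : ℕ → ℝ)
    (hab : ∀ i, a i ≤ b i) (hC : ∀ i, IsClosed (C i))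
    (hCg : ∀ i y, e y ∈ C i → g y ∈ Icc (a i) (b i))
    (hsmall : ∀ y, ∀ ε > 0, ∃ i, e y ∈ C i ∧ b i - a i < ε) :
    ∃ φ : ℕ → C(K, ℝ), ∀ y, Tendsto (fun n => φ n (e y)) atTop (𝓝 (g y)) := by
  let _ := TopologicalSpace.metrizableSpaceMetric K
  let P : ℕ → ℕ → Prop := fun i j => a i ≤ b j ∧ a j ≤ b i
  -- Earlier closed sets with a conflicting interval are removed; the open complement is `F_σ`, so
  -- closed pieces remain. No point `e y` of `C j` is lost, since `g y` lies in both intervals.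
  let B : ℕ → Set K := fun j => ⋃ i ∈ {i | i < j ∧ ¬ P i j}, C i
  have hB : ∀ j, IsClosed (B j) := fun j =>
    ((finite_lt_nat j).subset fun i hi => hi.1).isClosed_biUnion fun i _ => hC i
  choose E hEc hEB hEU _ using fun j => (hB j).isOpen_compl.exists_iUnion_isClosed
  let C' : ℕ × ℕ → Set K := fun p => C p.1 ∩ E p.1 p.2
  have hcompat : ∀ p q, (C' p ∩ C' q).Nonempty → P p.1 q.1 := by
    have key : ∀ p q : ℕ × ℕ, p.1 < q.1 → (C' p ∩ C' q).Nonempty → P p.1 q.1 := by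
      rintro p q hlt ⟨x, hxp, hxq⟩
      by_contra hP
      exact hEB _ _ hxq.2 (mem_biUnion (show p.1 ∈ {i | i < q.1 ∧ ¬ P i q.1} from ⟨hlt, hP⟩) hxp.1)
    intro p q hne
    rcases lt_trichotomy p.1 q.1 with hlt | heq | hlt
    · exact key p q hlt hne
    · exact ⟨heq ▸ hab p.1, heq ▸ hab p.1⟩
    · rw [inter_comm] at hne
      exact (key q p hlt hne).symm
  have hex : ∀ n, ∃ φ : C(K, ℝ), ∀ p ∈ Finset.range n ×ˢ Finset.range n,
      ∀ x ∈ C' p, φ x ∈ Icc (a p.1) (b p.1) := fun n =>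
    exists_continuous_mem_Icc _ (fun p _ => (hC _).inter (hEc _ _))
      fun p _ q _ hne => (hcompat p q hne).1
  choose φ hφ using hex
  refine ⟨φ, fun y => Metric.tendsto_atTop.2 fun ε hε => ?_⟩
  obtain ⟨i, hi, hlt⟩ := hsmall y ε hε
  have hy : e y ∈ (B i)ᶜ := by
    intro hmem
    obtain ⟨j, hj, hyj⟩ := mem_iUnion₂.1 hmem
    have h1 := hCg i y hi
    have h2 := hCg j y hyj
    exact hj.2 ⟨h2.1.trans h1.2, h1.1.trans h2.2⟩
  rw [← hEU i] at hy
  obtain ⟨k, hk⟩ := mem_iUnion.1 hy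
  refine ⟨max i k + 1, fun n hn => ?_⟩
  have h1 := hφ n (i, k) (by simp only [Finset.mem_product, Finset.mem_range]; omega) _ ⟨hi, hk⟩
  have h2 := hCg i y hi
  rw [Real.dist_eq, abs_lt]
  constructor <;> linarith [h1.1, h1.2, h2.1, h2.2]

end Interpolation

/-! ### Property `V` and sequential separability of `C_p(X)`. -/

section Condensation

variable {X : Type u} [TopologicalSpace X]

theorem IsFSigma.exists_seq {A : Set X} (hA : IsFSigma A) :
    ∃ C : ℕ → Set X, (∀ k, IsClosed (C k)) ∧ A = ⋃ k, C k := by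
  obtain ⟨T, hT, hTc, rfl⟩ := hA
  obtain ⟨C, hC⟩ := (hT.insert ∅).exists_eq_range (insert_nonempty _ _)
  refine ⟨C, fun k => ?_, ?_⟩
  · have : C k ∈ insert ∅ T := hC ▸ mem_range_self k
    rcases this with h | h
    · exact h ▸ isClosed_empty
    · exact hTc _ h
  · rw [← sUnion_range, ← hC, sUnion_insert, empty_union]

theorem isCozeroSet_preimage_Ioo {h : X → ℝ} (hh : Continuous h) (p q : ℝ) :
    IsCozeroSet (h ⁻¹' Ioo p q) := by
  refine ⟨fun x => max (min (h x - p) (q - h x)) 0, by fun_prop, ?_⟩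
  ext x
  simp only [mem_compl_iff, mem_preimage, mem_Ioo, mem_ofPred_eq, max_eq_right_iff, min_le_iff,
    sub_nonpos, not_and_or, not_lt]

theorem PropertyV.sequentiallySeparable (hX : PropertyV X) : SequentiallySeparable (Cp X) := by
  obtain ⟨Y, _, _, f, hf, hbij, hfσ⟩ := hX
  obtain ⟨e, he⟩ := Metric.PiNatEmbed.exists_embedding_to_hilbert_cube (X := Y)
  let r : C(ℕ → unitInterval, ℝ) → Cp X := fun φ =>
    ⟨fun x => φ (e (f x)), φ.continuous.comp (he.continuous.comp hf)⟩
  obtain ⟨D, hDc, hD⟩ := TopologicalSpace.exists_countable_dense C(ℕ → unitInterval, ℝ)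
  refine ⟨r '' D, hDc.image r, mem_seqDense_iff.2 fun h => ?_⟩
  let Q := {p : ℚ × ℚ // p.1 < p.2}
  have hQ : Nonempty Q := ⟨⟨(0, 1), by norm_num⟩⟩
  choose T hTc hT using fun p : Q =>
    (hfσ _ (isCozeroSet_preimage_Ioo h.2 p.1.1 p.1.2)).exists_seq
  -- Closed sets of `Y` are traces of closed sets of the Hilbert cube.
  choose C hC hCT using fun p k => he.isClosed_iff.1 (hTc p k)
  have hmem : ∀ (p : Q) x, h.1 x ∈ Ioo (p.1.1 : ℝ) p.1.2 ↔ ∃ k, e (f x) ∈ C p k := fun p x => by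
    have : f x ∈ f '' (h.1 ⁻¹' Ioo (p.1.1 : ℝ) p.1.2) ↔ ∃ k, f x ∈ T p k := by
      rw [hT, mem_iUnion]
    rw [hbij.1.mem_set_image] at this
    refine this.trans (exists_congr fun k => ?_)
    rw [← hCT, mem_preimage]
  obtain ⟨σ, hσ⟩ := exists_surjective_nat (Q × ℕ)
  obtain ⟨φ, hφ⟩ := exists_seq_tendsto_of_closed (fun x => e (f x)) h.1
    (fun i => C (σ i).1 (σ i).2) (fun i => ((σ i).1.1.1 : ℝ)) (fun i => ((σ i).1.1.2 : ℝ))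
    (fun i => by exact_mod_cast (σ i).1.2.le) (fun i => hC _ _)
    (fun i x hx => Ioo_subset_Icc_self ((hmem _ x).2 ⟨_, hx⟩))
    (fun x ε hε => by
      obtain ⟨p, hp1, hp2⟩ := exists_rat_btwn (show h.1 x - ε / 2 < h.1 x by linarith)
      obtain ⟨q, hq1, hq2⟩ := exists_rat_btwn (show h.1 x < h.1 x + ε / 2 by linarith)
      have hpq : p < q := by exact_mod_cast hp2.trans hq1
      obtain ⟨k, hk⟩ := (hmem ⟨(p, q), hpq⟩ x).1 ⟨hp2, hq1⟩
      obtain ⟨i, hi⟩ := hσ (⟨(p, q), hpq⟩, k)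
      refine ⟨i, ?_, ?_⟩
      · rw [hi]
        exact hk
      · rw [hi]
        dsimp only
        linarith)
  choose d hd hdφ using fun n : ℕ =>
    hD.exists_dist_lt (φ n) (show (0 : ℝ) < 1 / ((n : ℝ) + 1) from Nat.one_div_pos_of_nat)
  refine ⟨fun n => r (d n), fun n => mem_image_of_mem r (hd n), tendsto_cp_iff.2 fun x => ?_⟩
  refine (hφ x).congr_dist (squeeze_zero (fun _ => dist_nonneg) (fun n => ?_)
    tendsto_one_div_add_atTop_nhds_zero_nat)
  exact (ContinuousMap.dist_apply_le_dist _).trans (hdφ n).le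

theorem SequentiallySeparable.propertyV [T35Space X] (hX : SequentiallySeparable (Cp X)) :
    PropertyV X := by
  obtain ⟨D, hDc, hD⟩ := hX
  rw [mem_seqDense_iff] at hD
  have := hDc.to_subtype
  let E : X → D → ℝ := fun x d => d.1.1 x
  have hE : Continuous E := continuous_pi fun d => d.1.2
  have hinj : Function.Injective E := by
    intro x y hxy
    by_contra hne
    obtain ⟨f, hf, hfx, hfy⟩ := CompletelyRegularSpace.completely_regular x {y} isClosed_singleton
      hne
    obtain ⟨g, hgD, hg⟩ := hD ⟨fun z => (f z : ℝ), by fun_prop⟩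
    rw [tendsto_cp_iff] at hg
    have hgxy : (fun k => (g k).1 x) = fun k => (g k).1 y :=
      funext fun k => congrFun hxy ⟨g k, hgD k⟩
    have := tendsto_nhds_unique (hgxy ▸ hg x) (hg y)
    have hfy' := hfy (mem_singleton y)
    simp [hfx, hfy'] at this
  refine ⟨range E, TopologicalSpace.metrizableSpaceMetric _, inferInstance, rangeFactorization E,
    hE.subtype_mk _, ⟨fun x y hxy => hinj (congrArg Subtype.val hxy),
      rangeFactorization_surjective⟩, fun U hU => ?_⟩
  obtain ⟨h, hh, hU⟩ := hU
  obtain ⟨g, hgD, hg⟩ := hD ⟨h, hh⟩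
  rw [tendsto_cp_iff] at hg
  -- `h x ≠ 0` exactly when `|g n x|` is eventually bounded below by some `1 / (m + 1)`; each such
  -- condition is closed in the coordinates from `D`.
  let C : ℕ × ℕ → Set (range E) := fun p =>
    {y | ∀ n ≥ p.2, 1 / ((p.1 : ℝ) + 1) ≤ |y.1 ⟨g n, hgD n⟩|}
  refine ⟨range C, countable_range C, ?_, ?_⟩
  · rintro _ ⟨p, rfl⟩
    simp only [C, ofPred_forall]
    exact isClosed_iInter fun n => isClosed_iInter fun _ => isClosed_le continuous_const
      (((continuous_apply _).comp continuous_subtype_val).abs)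
  · have hUx : ∀ x, x ∈ U ↔ h x ≠ 0 := fun x => by
      rw [← not_iff_not, ← mem_compl_iff, hU, mem_ofPred_eq, not_not]
    ext y
    obtain ⟨x, rfl⟩ := rangeFactorization_surjective y
    have hinj' : Function.Injective (rangeFactorization E) := fun x y hxy =>
      hinj (congrArg Subtype.val hxy)
    rw [hinj'.mem_set_image, hUx, sUnion_range, mem_iUnion]
    constructor
    · intro hx
      obtain ⟨m, hm⟩ := exists_nat_one_div_lt (abs_pos.2 hx)
      obtain ⟨N, hN⟩ := eventually_atTop.1 ((hg x).abs.eventually_const_lt hm)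
      exact ⟨(m, N), fun n hn => (hN n hn).le⟩
    · rintro ⟨p, hp⟩ hx
      have hle := ge_of_tendsto (hg x).abs (eventually_atTop.2 ⟨p.2, hp⟩)
      have hpos : (0 : ℝ) < 1 / ((p.1 : ℝ) + 1) := Nat.one_div_pos_of_nat
      simp only [hx, abs_zero] at hle
      linarith

end Condensation

end CpSel

theorem mainTheorem7 (X : Type u) [TopologicalSpace X] [T35Space X] :
    List.TFAE [
      CpSel.UFinSS X ∧ CpSel.SequentiallySeparable (CpSel.Cp X),
      CpSel.UFin (CpSel.GammaF X) (CpSel.Gamma X) ∧ CpSel.PropertyV X,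
      CpSel.UFinGammaGamma X ∧ CpSel.SequentiallySeparable (CpSel.Cp X),
      CpSel.UFinSGamma X ∧ CpSel.SequentiallySeparable (CpSel.Cp X)] := by
  tfae_have 1 → 4 := fun h => ⟨h.1.uFinSGamma, h.2⟩
  tfae_have 3 → 4 := fun h => ⟨h.1.uFinSGamma, h.2⟩
  tfae_have 4 → 2 := fun h => ⟨h.1.seqUFin.uFin, h.2.propertyV⟩
  tfae_have 2 → 1 := fun h =>
    ⟨h.1.seqUFin.uFinSS h.2.sequentiallySeparable, h.2.sequentiallySeparable⟩
  tfae_have 2 → 3 := fun h => ⟨h.1.seqUFin.uFinGammaGamma, h.2.sequentiallySeparable⟩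
  tfae_finish
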